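/- A threshold gate outputs $[\sum_i c_i x_i \ge t]$, where the $c_i$ are nonnegative integers ($c_i$ is the number of occurrences of $x_i$ in the gate, and $c_i=0$ means that $x_i$ is not an input of it) and $t$ is an arbitrary real threshold. A $\mathrm{MAJ}_k\circ\mathrm{MAJ}_k$ circuit on $x_1,\dots,x_n\in\{0,1\}$ is a depth-two formula consisting of a top threshold gate applied to the outputs of finitely many bottom threshold gates, each of which reads the variables $x_1,\dots,x_n$, such that in every gate (top and bottom) the coefficients satisfy $\sum_i c_i\le k$. Let $\mathrm{MAJ}_n(x_1,\dots,x_n)=[\sum_{i=1}^n x_i\ge n/2]$. Suppose that a $\mathrm{MAJ}_k\circ\mathrm{MAJ}_k$ circuit computes $\mathrm{MAJ}_n$ on all inputs in $\{0,1\}^n$ and that each variable occurs at most once in each bottom gate (all coefficients of the bottom gates are at most $1$; the top gate is not restricted in this way). Then $k=\Omega\bigl(n^{7/10}(\log n)^{-1/5}\bigr)$. That is, there are absolute constants $c>0$ and $n_0$ such that for all $n\ge n_0$ and all $k$, every such circuit satisfies $k\ge c\,n^{7/10}(\log n)^{-1/5}$. -/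

import Mathlib

/-- A monotone threshold gate `[∑ cᵢ xᵢ ≥ t]` with inputs indexed by `ι`, nonnegative integer
coefficients and an arbitrary threshold. The inputs of the gate are the indices of positive
coefficient; `weight i` is the number of times that `i` occurs in the gate. -/
structure ThresholdGate (ι : Type) where
  weight : ι → ℕ
  threshold : ℝ

namespace ThresholdGate

/-- The sum of the coefficients, i.e. the fan-in of the gate counted with multiplicity. -/
def size {ι : Type} [Fintype ι] (G : ThresholdGate ι) : ℕ :=
  ∑ i, G.weight i

/-- The value `[∑ cᵢ xᵢ ≥ t]` of the gate on the assignment `x`. -/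
noncomputable def eval {ι : Type} [Fintype ι] (G : ThresholdGate ι) (x : ι → Bool) : Bool :=
  decide (G.threshold ≤ ((∑ i, G.weight i * (x i).toNat : ℕ) : ℝ))

end ThresholdGate

/-- The standard majority function `[x₁ + ⋯ + xₙ ≥ n / 2]`. -/
noncomputable def majority (n : ℕ) (x : Fin n → Bool) : Bool :=
  decide ((n : ℝ) / 2 ≤ ((∑ i, (x i).toNat : ℕ) : ℝ))

/-- A depth two threshold formula over `n` variables: a top gate whose inputs are finitely many
bottom gates, and the bottom gates read the variables. -/
structure DepthTwoCircuit (n : ℕ) where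
  numGates : ℕ
  bottom : Fin numGates → ThresholdGate (Fin n)
  top : ThresholdGate (Fin numGates)

namespace DepthTwoCircuit

/-- The Boolean function computed by the circuit. -/
noncomputable def eval {n : ℕ} (C : DepthTwoCircuit n) (x : Fin n → Bool) : Bool :=
  C.top.eval fun j => (C.bottom j).eval x

/-- The circuit is a `MAJ_k ∘ MAJ_k` circuit: in each gate, the coefficients sum to at most `k`. -/
def IsMajMaj {n : ℕ} (C : DepthTwoCircuit n) (k : ℕ) : Prop :=
  C.top.size ≤ k ∧ ∀ j, (C.bottom j).size ≤ k

/-- Each variable occurs at most once in each bottom gate (the top gate is unrestricted). -/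
def UnweightedBottom {n : ℕ} (C : DepthTwoCircuit n) : Prop :=
  ∀ j i, (C.bottom j).weight i ≤ 1

/-- The circuit computes the majority of its `n` variables on all inputs. -/
def ComputesMajority {n : ℕ} (C : DepthTwoCircuit n) : Prop :=
  ∀ x : Fin n → Bool, C.eval x = majority n x

end DepthTwoCircuit

/-!
The bound proved is in fact linear: `n / 4 ≤ k`. The argument is the polynomial method modulo a
prime `p` with `n / 4 < p ≤ n / 2`, which exists by Bertrand's postulate.

At an input with exactly `⌈n / 2⌉` ones, switching any of these ones off changes the majority, hence
changes some bottom gate that reads it. As the coefficients are at most one, this gate is *tight*: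
its sum is equal to its rounded-up threshold (`exists_tight_gate`). Fix all but `2 * p - 1` of the
variables so that the inputs with exactly `p` free ones have `⌈n / 2⌉` ones altogether. Every gate
that is tight at one of these inputs and reads one of its free ones has a reduced threshold, with
the contribution of the fixed ones subtracted, between `1` and `k`. Let `f` be the product, over
all gates that are inputs of the top gate and have a reduced threshold between `1` and `k`, of
(sum over the free ones) - (reduced threshold). Then `f` is a product of at most `k` affine forms
that vanishes wherever exactly `p` of the free variables are one.

Modulo `p`, a product of fewer than `p` affine forms in `2 * p - 1` Boolean variables has the sum
of its values over the inputs of weight `p` equal to its value at zero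
(`sum_powersetCard_prod_affine`), because for `d < p` the number of `p`-subsets of a
`(2 * p - 1)`-set containing a given `d`-subset is `1` modulo `p` for `d = 0` and `0` otherwise. If
`k < p`, then `f` has fewer than `p` factors, and its value at zero is up to sign a product of
integers between `1` and `k < p`, so it is nonzero modulo `p`: a contradiction. Hence `p ≤ k`.
-/

open Finset

/-! ### Binomial sums modulo a prime -/

lemma natCast_choose_two_mul_sub_one {p : ℕ} [Fact p.Prime] :
    ((Nat.choose (2 * p - 1) p : ℕ) : ZMod p) = 1 := by
  have hp := (Fact.out : p.Prime).pos
  have h := Choose.choose_modEq_choose_mod_mul_choose_div_nat (p := p) (n := 2 * p - 1) (k := p)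
  have hdiv : (2 * p - 1) / p = 1 := by
    rw [Nat.div_eq_iff hp]
    omega
  rw [Nat.mod_self, Nat.choose_zero_right, Nat.div_self hp, hdiv, Nat.choose_self, one_mul] at h
  simpa using (ZMod.natCast_eq_natCast_iff _ _ _).2 h

/-- The number of `p`-subsets of a `(2 * p - 1)`-set that contain a given set `I` of fewer than `p`
elements, modulo `p`. -/
lemma natCast_card_filter_subset_powersetCard {α : Type*} [DecidableEq α] {p : ℕ} [Fact p.Prime]
    {F I : Finset α} (hF : #F = 2 * p - 1) (hIF : I ⊆ F) (hI : #I < p) :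
    ((#((F.powersetCard p).filter (I ⊆ ·)) : ℕ) : ZMod p) = if I = ∅ then 1 else 0 := by
  split_ifs with h
  · subst h
    simpa [hF] using natCast_choose_two_mul_sub_one (p := p)
  · have hpos : 0 < #I := card_pos.2 (nonempty_iff_ne_empty.2 h)
    rw [card_filter_powersetCard_subset I F p hIF hI.le, hF, ZMod.natCast_eq_zero_iff]
    exact (Fact.out : p.Prime).dvd_choose (by omega) (by omega) (by omega)

/-- A product of affine forms times the monomial indexed by `I`, of total degree less than `p`:
modulo `p`, its values at the `p`-subsets of a `(2 * p - 1)`-set sum to its value at the empty set.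
The monomial is what lets the affine forms be expanded one at a time. -/
lemma sum_powersetCard_monomial_mul_prod_affine {α ι : Type*} [DecidableEq α] [DecidableEq ι]
    {p : ℕ} [Fact p.Prime] {F : Finset α} (hF : #F = 2 * p - 1) (w : ι → α → ZMod p)
    (b : ι → ZMod p) (J : Finset ι) :
    ∀ I ⊆ F, #I + #J < p →
      ∑ Y ∈ F.powersetCard p, (if I ⊆ Y then 1 else 0) * ∏ j ∈ J, (∑ i ∈ Y, w j i + b j) =
        (if I = ∅ then 1 else 0) * ∏ j ∈ J, b j := by
  induction J using Finset.induction_on with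
  | empty =>
    intro I hIF hI
    simpa using natCast_card_filter_subset_powersetCard hF hIF (by simpa using hI)
  | insert j J hj ih =>
    intro I hIF hI
    rw [card_insert_of_notMem hj] at hI
    have expand : ∀ Y ∈ F.powersetCard p,
        (if I ⊆ Y then (1 : ZMod p) else 0) * ∏ l ∈ insert j J, (∑ i ∈ Y, w l i + b l) =
          ∑ i ∈ F, w j i *
            ((if insert i I ⊆ Y then 1 else 0) * ∏ l ∈ J, (∑ i ∈ Y, w l i + b l)) +
          b j * ((if I ⊆ Y then 1 else 0) * ∏ l ∈ J, (∑ i ∈ Y, w l i + b l)) := by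
      intro Y hY
      have hYF := (mem_powersetCard.1 hY).1
      have hsum : ∑ i ∈ Y, w j i = ∑ i ∈ F, w j i * (if i ∈ Y then 1 else 0) := by
        simp only [mul_ite, mul_one, mul_zero, ← sum_filter]
        rw [filter_mem_eq_inter, inter_eq_right.2 hYF]
      rw [prod_insert hj, hsum, add_mul, mul_add, sum_mul, mul_sum]
      congr 1
      · refine sum_congr rfl fun i _ => ?_
        by_cases h1 : i ∈ Y <;> by_cases h2 : I ⊆ Y <;> simp [insert_subset_iff, h1, h2]
      · ring
    rw [sum_congr rfl expand, sum_add_distrib, sum_comm, ← mul_sum, ih I hIF (by omega),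
      prod_insert hj]
    have hzero : ∀ i ∈ F, ∑ Y ∈ F.powersetCard p, w j i *
        ((if insert i I ⊆ Y then 1 else 0) * ∏ l ∈ J, (∑ i ∈ Y, w l i + b l)) = 0 := by
      intro i hi
      have hcard := card_insert_le i I
      rw [← mul_sum, ih (insert i I) (insert_subset hi hIF) (by omega)]
      simp
    rw [sum_eq_zero hzero]
    ring

/-- Modulo `p`, a product of fewer than `p` affine forms in `2 * p - 1` Boolean variables has the
sum of its values over the inputs of weight `p` equal to its value at zero. -/
lemma sum_powersetCard_prod_affine {α ι : Type*} [DecidableEq α] [DecidableEq ι]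
    {p : ℕ} [Fact p.Prime] {F : Finset α} (hF : #F = 2 * p - 1) (w : ι → α → ZMod p)
    (b : ι → ZMod p) {J : Finset ι} (hJ : #J < p) :
    ∑ Y ∈ F.powersetCard p, ∏ j ∈ J, (∑ i ∈ Y, w j i + b j) = ∏ j ∈ J, b j := by
  simpa using sum_powersetCard_monomial_mul_prod_affine hF w b J ∅ (by simp) (by simpa using hJ)

/-! ### Tight gates -/

/-- The assignment that is one exactly on `X`. -/
def indicatorInput {n : ℕ} (X : Finset (Fin n)) : Fin n → Bool := fun i => decide (i ∈ X)

lemma sum_mul_indicatorInput {n : ℕ} (w : Fin n → ℕ) (X : Finset (Fin n)) :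
    ∑ i, w i * (indicatorInput X i).toNat = ∑ i ∈ X, w i := by
  simp [indicatorInput, Bool.toNat, Bool.cond_decide]

lemma ThresholdGate.eval_indicatorInput {n : ℕ} (G : ThresholdGate (Fin n)) (X : Finset (Fin n)) :
    G.eval (indicatorInput X) = decide (⌈G.threshold⌉ ≤ ((∑ i ∈ X, G.weight i : ℕ) : ℤ)) := by
  simp only [ThresholdGate.eval, sum_mul_indicatorInput, Int.ceil_le, Int.cast_natCast]

lemma majority_indicatorInput {n : ℕ} (X : Finset (Fin n)) :
    majority n (indicatorInput X) = decide (n ≤ 2 * #X) := by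
  have h := sum_mul_indicatorInput (fun _ => 1) X
  simp only [one_mul, sum_const, smul_eq_mul, mul_one] at h
  rw [majority, h]
  refine decide_eq_decide.2 ?_
  rw [div_le_iff₀ two_pos, mul_comm]
  exact_mod_cast Iff.rfl

/-- Every one of an input with exactly `⌈n / 2⌉` ones is read by a gate whose sum there is equal to
its rounded-up threshold. -/
lemma exists_tight_gate {n : ℕ} {C : DepthTwoCircuit n} (hU : C.UnweightedBottom)
    (hC : C.ComputesMajority) {X : Finset (Fin n)} (hX : #X = (n + 1) / 2) {i : Fin n}
    (hi : i ∈ X) :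
    ∃ j, C.top.weight j ≠ 0 ∧ (C.bottom j).weight i = 1 ∧
      ⌈(C.bottom j).threshold⌉ = ((∑ l ∈ X, (C.bottom j).weight l : ℕ) : ℤ) := by
  by_contra! hcon
  have hpos : 0 < #X := card_pos.2 ⟨i, hi⟩
  have hsame : C.eval (indicatorInput X) = C.eval (indicatorInput (X.erase i)) := by
    have hgate : ∀ j, C.top.weight j ≠ 0 →
        (C.bottom j).eval (indicatorInput X) =
          (C.bottom j).eval (indicatorInput (X.erase i)) := by
      intro j hj
      rw [ThresholdGate.eval_indicatorInput, ThresholdGate.eval_indicatorInput]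
      have hadd := add_sum_erase X (C.bottom j).weight hi
      have hle := hU j i
      have hne := hcon j hj
      refine decide_eq_decide.2 ?_
      rcases Nat.le_one_iff_eq_zero_or_eq_one.1 hle with h | h
      · rw [← hadd, h, zero_add]
      · have := hne h
        omega
    have hsum : ∑ j, C.top.weight j * ((C.bottom j).eval (indicatorInput X)).toNat =
        ∑ j, C.top.weight j * ((C.bottom j).eval (indicatorInput (X.erase i))).toNat := by
      refine sum_congr rfl fun j _ => ?_
      by_cases hj : C.top.weight j = 0
      · simp [hj]
      · rw [hgate j hj]
    rw [DepthTwoCircuit.eval, DepthTwoCircuit.eval, ThresholdGate.eval, ThresholdGate.eval, hsum]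
  rw [hC, hC, majority_indicatorInput, majority_indicatorInput, decide_eq_decide,
    card_erase_of_mem hi] at hsame
  omega

/-! ### The linear lower bound -/

/-- Any prime `p ≤ n / 2` bounds from below the fan-in of a depth-two circuit for the majority. -/
theorem prime_le_of_computesMajority {n k p : ℕ} (hp : p.Prime) (hpn : 2 * p ≤ n)
    {C : DepthTwoCircuit n} (hk : C.IsMajMaj k) (hU : C.UnweightedBottom)
    (hC : C.ComputesMajority) : p ≤ k := by
  have : Fact p.Prime := ⟨hp⟩
  by_contra! hkp
  -- `F` consists of the free variables, and `O` of those fixed to one.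
  obtain ⟨F, -, hF⟩ := exists_subset_card_eq (s := (univ : Finset (Fin n))) (n := 2 * p - 1)
    (by rw [card_univ, Fintype.card_fin]; omega)
  obtain ⟨O, hO, hOc⟩ := exists_subset_card_eq (s := Fᶜ) (n := (n + 1) / 2 - p)
    (by rw [card_compl, hF, Fintype.card_fin]; omega)
  let T : Fin C.numGates → ℤ := fun j =>
    ⌈(C.bottom j).threshold⌉ - ((∑ l ∈ O, (C.bottom j).weight l : ℕ) : ℤ)
  let J : Finset (Fin C.numGates) := univ.filter fun j => C.top.weight j ≠ 0 ∧ 1 ≤ T j ∧ T j ≤ k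
  have hJ : #J < p := by
    refine lt_of_le_of_lt ?_ hkp
    calc #J = ∑ j ∈ J, 1 := by simp
      _ ≤ ∑ j ∈ J, C.top.weight j := sum_le_sum fun j hj =>
          Nat.one_le_iff_ne_zero.2 (mem_filter.1 hj).2.1
      _ ≤ C.top.size := sum_le_univ_sum_of_nonneg fun _ => Nat.zero_le _
      _ ≤ k := hk.1
  have hmain := sum_powersetCard_prod_affine hF
    (fun j i => (((C.bottom j).weight i : ℕ) : ZMod p)) (fun j => -((T j : ℤ) : ZMod p)) hJ
  have hvanish : ∀ Y ∈ F.powersetCard p,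
      ∏ j ∈ J, (∑ i ∈ Y, (((C.bottom j).weight i : ℕ) : ZMod p) + -((T j : ℤ) : ZMod p)) = 0 := by
    intro Y hY
    obtain ⟨hYF, hYc⟩ := mem_powersetCard.1 hY
    have hdisj : Disjoint O Y :=
      disjoint_of_subset_left hO (disjoint_of_subset_right hYF disjoint_compl_left)
    obtain ⟨i, hi⟩ : Y.Nonempty := card_pos.1 (hYc ▸ hp.pos)
    obtain ⟨j, hj, hwi, htight⟩ := exists_tight_gate hU hC (X := O ∪ Y)
      (by rw [card_union_of_disjoint hdisj, hOc, hYc]; omega) (mem_union_right O hi)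
    have hT : T j = ((∑ l ∈ Y, (C.bottom j).weight l : ℕ) : ℤ) := by
      simp only [T, htight, sum_union hdisj]
      push_cast
      ring
    have h1 : 1 ≤ ∑ l ∈ Y, (C.bottom j).weight l :=
      hwi ▸ single_le_sum (f := (C.bottom j).weight) (fun _ _ => Nat.zero_le _) hi
    have h2 : ∑ l ∈ Y, (C.bottom j).weight l ≤ k :=
      (sum_le_univ_sum_of_nonneg fun _ => Nat.zero_le _).trans (hk.2 j)
    refine prod_eq_zero (i := j) (mem_filter.2 ⟨mem_univ j, hj, ?_, ?_⟩) ?_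
    · rw [hT]
      exact_mod_cast h1
    · rw [hT]
      exact_mod_cast h2
    · rw [hT]
      push_cast
      ring
  rw [sum_eq_zero hvanish, eq_comm, prod_eq_zero_iff] at hmain
  obtain ⟨j, hj, hzero⟩ := hmain
  obtain ⟨-, -, h1, h2⟩ := mem_filter.1 hj
  rw [neg_eq_zero, ZMod.intCast_zmod_eq_zero_iff_dvd] at hzero
  have := Int.le_of_dvd (by omega) hzero
  omega

theorem mainTheorem3 :
    ∃ c : ℝ, 0 < c ∧ ∃ n₀ : ℕ, ∀ n : ℕ, n₀ ≤ n → ∀ (k : ℕ) (C : DepthTwoCircuit n),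
      C.IsMajMaj k → C.UnweightedBottom → C.ComputesMajority →
        c * ((n : ℝ) ^ (7 / 10 : ℝ) * Real.log (n : ℝ) ^ (-(1 / 5) : ℝ)) ≤ (k : ℝ) := by
  refine ⟨1 / 4, by norm_num, 4, fun n hn k C hk hU hC => ?_⟩
  obtain ⟨p, hp, hlt, hle⟩ := Nat.exists_prime_lt_and_le_two_mul (n / 4) (by omega)
  have hpk : p ≤ k := prime_le_of_computesMajority hp (by omega) hk hU hC
  have hnk : (n : ℝ) ≤ 4 * k := by
    have : n ≤ 4 * k := by omega
    exact_mod_cast this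
  have hn4 : (4 : ℝ) ≤ n := by exact_mod_cast hn
  have hlog : 1 ≤ Real.log n := by
    rw [Real.le_log_iff_exp_le (by linarith)]
    linarith [Real.exp_one_lt_d9]
  have h1 : (n : ℝ) ^ (7 / 10 : ℝ) ≤ n := by
    simpa using Real.rpow_le_rpow_of_exponent_le (by linarith : (1 : ℝ) ≤ n)
      (by norm_num : (7 / 10 : ℝ) ≤ 1)
  have h2 : Real.log (n : ℝ) ^ (-(1 / 5) : ℝ) ≤ 1 :=
    Real.rpow_le_one_of_one_le_of_nonpos hlog (by norm_num)
  have h3 : (n : ℝ) ^ (7 / 10 : ℝ) * Real.log (n : ℝ) ^ (-(1 / 5) : ℝ) ≤ n * 1 :=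
    mul_le_mul h1 h2 (Real.rpow_nonneg (by linarith) _) (by linarith)
  linarith
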